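/- Let $F=F(a,b)$ be the free group of rank two. For $t\in(0,1)$ and a conjugacy class $w$ of $F$, let $\ell_t(w)$ be the length of the cyclically reduced form of any element of $w$, where each letter $a^{\pm1}$ has length $t$ and each letter $b^{\pm1}$ has length $1-t$. An element of $F$ is primitive if it belongs to some free basis of $F$; let $\mathcal P$ be the set of conjugacy classes of primitive elements of $F$. Let $f:(0,\infty)\to[0,\infty)$ be a twice differentiable function such that $f''(x)>0$ for every $x>0$ and such that $\lim_{x\to\infty}x^{3+\varepsilon}f(x)=0$ for some $\varepsilon>0$. For $t\in(0,1)$ put \[ P_f(t)=\sum_{w\in\mathcal P} f(\ell_t(w))\in[0,\infty]. \] Then: (a) $0<P_f(t)<\infty$ for every $t\in(0,1)$. (b) The function $P_f$ is strictly convex on $(0,1)$ and achieves a unique minimum on $(0,1)$, at $t=1/2$. In particular, $P_f$ is not constant on any neighborhood of $1/2$, and hence it is not constant on $(0,1)$. -/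

import Mathlib

open Set Filter Topology

namespace McShaneFree

universe u

variable {α : Type u}

/-- An element of the free group `F(α)` is primitive if it belongs to some free basis of `F(α)`. -/
def IsPrimitive (g : FreeGroup α) : Prop :=
  ∃ (ι : Type u) (b : FreeGroupBasis ι (FreeGroup α)) (i : ι), b i = g

/-- The set of conjugacy classes of primitive elements of `F(α)`. -/
def primitiveClasses (α : Type u) : Set (ConjClasses (FreeGroup α)) :=
  {c | ∃ g : FreeGroup α, IsPrimitive g ∧ ConjClasses.mk g = c}

/-- The length of a word, where every letter `x` or `x⁻¹` has length `L x`. -/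
def wordLength (L : α → ℝ) (w : List (α × Bool)) : ℝ :=
  (w.map fun x => L x.1).sum

variable [DecidableEq α]

/-- The cyclically reduced form of `g` with respect to the standard basis. -/
def cyclicForm (g : FreeGroup α) : List (α × Bool) :=
  FreeGroup.reduceCyclically g.toWord

theorem count_map_fst_invRev (x : α) (w : List (α × Bool)) :
    ((FreeGroup.invRev w).map Prod.fst).count x = (w.map Prod.fst).count x := by
  simp [FreeGroup.invRev, List.map_reverse, Function.comp_def]

theorem count_pow (x : α) (g : FreeGroup α) (n : ℕ) :
    ((g ^ (n + 1)).toWord.map Prod.fst).count x =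
      2 * ((FreeGroup.reduceCyclically.conjugator g.toWord).map Prod.fst).count x +
        (n + 1) * ((cyclicForm g).map Prod.fst).count x := by
  rw [FreeGroup.toWord_pow,
    FreeGroup.reduceCyclically.reduce_flatten_replicate_succ FreeGroup.isReduced_toWord]
  simp only [List.map_append, List.count_append, count_map_fst_invRev, List.map_flatten,
    List.map_replicate, List.count_flatten, List.sum_replicate, smul_eq_mul]
  unfold cyclicForm
  ring

theorem count_mul_le (x : α) (g h : FreeGroup α) :
    ((g * h).toWord.map Prod.fst).count x ≤
      (g.toWord.map Prod.fst).count x + (h.toWord.map Prod.fst).count x := by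
  have := ((FreeGroup.toWord_mul_sublist g h).map Prod.fst).count_le x
  simpa using this

theorem count_cyclicForm_conj_le (x : α) (g k : FreeGroup α) :
    ((cyclicForm (k * g * k⁻¹)).map Prod.fst).count x ≤
      ((cyclicForm g).map Prod.fst).count x := by
  by_contra! hlt
  set N := 2 * (k.toWord.map Prod.fst).count x +
    2 * ((FreeGroup.reduceCyclically.conjugator g.toWord).map Prod.fst).count x with hN
  have h1 := count_pow x (k * g * k⁻¹) N
  have h2 := count_pow x g N
  rw [conj_pow] at h1
  have h3 := count_mul_le x (k * g ^ (N + 1)) k⁻¹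
  have h4 := count_mul_le x k (g ^ (N + 1))
  rw [FreeGroup.toWord_inv, count_map_fst_invRev] at h3
  have h5 := Nat.mul_le_mul_left (N + 1) (Nat.succ_le_of_lt hlt)
  rw [Nat.succ_eq_add_one, Nat.mul_add] at h5
  omega

theorem wordLength_cyclicForm_eq_of_isConj (L : α → ℝ) (g h : FreeGroup α) (hgh : IsConj g h) :
    wordLength L (cyclicForm g) = wordLength L (cyclicForm h) := by
  have key : ((cyclicForm g).map Prod.fst).Perm ((cyclicForm h).map Prod.fst) := by
    obtain ⟨k, hk⟩ := isConj_iff.mp hgh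
    rw [List.perm_iff_count]
    intro x
    refine le_antisymm ?_ (hk ▸ count_cyclicForm_conj_le x g k)
    have hg : g = k⁻¹ * h * k⁻¹⁻¹ := by rw [← hk]; group
    calc ((cyclicForm g).map Prod.fst).count x
        = ((cyclicForm (k⁻¹ * h * k⁻¹⁻¹)).map Prod.fst).count x := by rw [← hg]
      _ ≤ _ := count_cyclicForm_conj_le x h k⁻¹
  have := (key.map L).sum_eq
  simpa [wordLength, List.map_map, Function.comp_def] using this

/-- The hyperbolic length function of the metric structure `L` on the wedge of circles indexed
by `α`: a conjugacy class is sent to the `L`-length of the cyclically reduced form of any of its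
elements. -/
def classLength (L : α → ℝ) : ConjClasses (FreeGroup α) → ℝ :=
  Quotient.lift (fun g => wordLength L (cyclicForm g)) (wordLength_cyclicForm_eq_of_isConj L)

/-- The sum of `f` over the lengths of all conjugacy classes of primitive elements, with value in
`[0, ∞]`. It is used for `f` that are nonnegative on `(0, ∞)` and for positive `L`; then all the
lengths that occur are positive. -/
noncomputable def primitiveSum (f : ℝ → ℝ) (L : α → ℝ) : ENNReal :=
  ∑' c : primitiveClasses α, ENNReal.ofReal (f (classLength L c))

/-- `P_f(t)`: the sum for `F(a, b)` with the metric structure `(t, 1 - t)`. -/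
noncomputable def P (f : ℝ → ℝ) (t : ℝ) : ENNReal :=
  primitiveSum f (![t, 1 - t] : Fin 2 → ℝ)

end McShaneFree

/-! The length of a class is `t * m + (1 - t) * n`, where `m` and `n` count its letters `a^{±1}` and
`b^{±1}`, hence affine in `t`. Each term of the sum is therefore convex in `t`, and the class of
`a`, of length `t`, makes the sum strictly convex. Exchanging the generators gives `P f (1 - t) = P
f t` (`P_one_sub`), so the minimum is at `1/2`.

What needs work is finiteness. Primitive classes are determined by their images in `ℤ²`
(`primitiveVec_injective`), and the length is at least `min t (1 - t)` times the norm of that image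
(`min_mul_norm_le_len`). The sum is thus dominated by a convergent lattice sum
(`summable_of_lattice`).

Injectivity is proved by Nielsen reduction in the Cayley tree: a shortest pair in a suitable family
of bases is Nielsen reduced, hence consists of letters. Running the reduction backwards writes every
automorphism as signed permutation, positive automorphism, signed permutation, up to an inner one
(`isEuclidean`). A positive automorphism has a nonnegative matrix, and a column of sum one forces
the image to be a letter; so an automorphism that fixes the homology class of `a` sends `a` to a
conjugate of `a`. -/

namespace McShaneFree

/-! ### Cancellation in free groups and Nielsen reduced sets -/

section Gromov

variable {α : Type*} [DecidableEq α]

/-- The length of the longest common prefix of two lists. -/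
def commonPrefixLength {β : Type*} [DecidableEq β] : List β → List β → ℕ
  | x :: l, y :: m => if x = y then commonPrefixLength l m + 1 else 0
  | _, _ => 0

theorem commonPrefixLength_comm {β : Type*} [DecidableEq β] (l m : List β) :
    commonPrefixLength l m = commonPrefixLength m l := by
  induction l generalizing m with
  | nil => cases m <;> simp [commonPrefixLength]
  | cons x l ih => cases m <;> simp [commonPrefixLength, ih, eq_comm]

/-- The ultrametric inequality of a tree, that is, 0-hyperbolicity of the Cayley graph. -/
theorem min_commonPrefixLength_le {β : Type*} [DecidableEq β] (l m n : List β) :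
    min (commonPrefixLength l m) (commonPrefixLength m n) ≤ commonPrefixLength l n := by
  induction l generalizing m n with
  | nil => cases m <;> simp [commonPrefixLength]
  | cons x l ih =>
    cases m with
    | nil => simp [commonPrefixLength]
    | cons y m =>
      cases n with
      | nil => simp [commonPrefixLength]
      | cons z n =>
        have := ih m n
        simp only [commonPrefixLength]
        split_ifs <;> simp_all

theorem take_commonPrefixLength {β : Type*} [DecidableEq β] (l m : List β) :
    l.take (commonPrefixLength l m) = m.take (commonPrefixLength l m) := by
  induction l generalizing m with
  | nil => cases m <;> simp [commonPrefixLength]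
  | cons x l ih =>
    cases m with
    | nil => simp [commonPrefixLength]
    | cons y m =>
      simp only [commonPrefixLength]
      split_ifs with h
      · simp [h, ih m]
      · simp

/-- Cancellation in `l⁻¹ m` removes exactly the common prefix from both words. -/
theorem length_reduce_invRev_append (l m : List (α × Bool)) (hl : FreeGroup.IsReduced l)
    (hm : FreeGroup.IsReduced m) :
    (FreeGroup.reduce (FreeGroup.invRev l ++ m)).length + 2 * commonPrefixLength l m =
      l.length + m.length := by
  induction l generalizing m with
  | nil =>
    rw [FreeGroup.invRev_empty, List.nil_append, hm.reduce_eq]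
    cases m <;> simp [commonPrefixLength]
  | cons x l ih =>
    cases m with
    | nil =>
      rw [List.append_nil, FreeGroup.reduce_invRev, hl.reduce_eq]
      simp [commonPrefixLength]
    | cons y m =>
      by_cases h : x = y
      · subst h
        have h1 : FreeGroup.reduce (FreeGroup.invRev (x :: l) ++ x :: m) =
            FreeGroup.reduce (FreeGroup.invRev l ++ m) := by
          apply FreeGroup.reduce.sound
          rw [← FreeGroup.mul_mk, ← FreeGroup.mul_mk, ← FreeGroup.inv_mk, ← FreeGroup.inv_mk,
            ← List.singleton_append, ← List.singleton_append (l := m), ← FreeGroup.mul_mk,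
            ← FreeGroup.mul_mk]
          group
        have h2 := ih m (hl.infix ⟨[x], [], by simp⟩) (hm.infix ⟨[x], [], by simp⟩)
        rw [h1]
        simp only [commonPrefixLength, if_true, List.length_cons]
        omega
      · have h1 : FreeGroup.IsReduced (FreeGroup.invRev (x :: l) ++ y :: m) := by
          have h2 : FreeGroup.IsReduced (FreeGroup.invRev (x :: l)) :=
            FreeGroup.IsReduced.of_reduce_eq (by rw [FreeGroup.reduce_invRev, hl.reduce_eq])
          refine List.IsChain.append h2 hm ?_
          intro p hp q hq
          simp [FreeGroup.invRev] at hp hq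
          subst hp hq
          intro h3
          simp only at h3 ⊢
          by_contra h4
          exact h (Prod.ext h3 (by revert h4; cases x.2 <;> cases y.2 <;> simp))
        rw [h1.reduce_eq]
        simp [commonPrefixLength, h]

/-- The Gromov product of two elements of a free group: the length of the longest common prefix
of their reduced words. -/
def gromovProduct (x y : FreeGroup α) : ℕ :=
  commonPrefixLength x.toWord y.toWord

theorem gromovProduct_comm (x y : FreeGroup α) : gromovProduct x y = gromovProduct y x :=
  commonPrefixLength_comm _ _

theorem norm_inv_mul_add (x y : FreeGroup α) :
    (x⁻¹ * y).norm + 2 * gromovProduct x y = x.norm + y.norm := by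
  have := length_reduce_invRev_append x.toWord y.toWord FreeGroup.isReduced_toWord
    FreeGroup.isReduced_toWord
  rwa [← FreeGroup.toWord_inv, ← FreeGroup.toWord_mul] at this

theorem norm_mul_add (x y : FreeGroup α) :
    (x * y).norm + 2 * gromovProduct x⁻¹ y = x.norm + y.norm := by
  have := norm_inv_mul_add x⁻¹ y
  rwa [inv_inv, FreeGroup.norm_inv_eq] at this

theorem min_gromovProduct_le (x y z : FreeGroup α) :
    min (gromovProduct x y) (gromovProduct y z) ≤ gromovProduct x z :=
  min_commonPrefixLength_le _ _ _

theorem gromovProduct_eq_of_lt {x y z : FreeGroup α} (h : gromovProduct x y < gromovProduct y z) :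
    gromovProduct x z = gromovProduct x y := by
  have h1 := min_gromovProduct_le x y z
  have h2 := min_gromovProduct_le x z y
  rw [gromovProduct_comm z y] at h2
  omega

theorem norm_pos {x : FreeGroup α} (hx : x ≠ 1) : 0 < x.norm :=
  Nat.pos_of_ne_zero fun h => hx (FreeGroup.norm_eq_zero.1 h)

/-- If `x = u c u⁻¹` with `c` cyclically reduced and nonempty, then `x * x = u c c u⁻¹` is reduced
and gains the length of `c`. -/
theorem norm_lt_norm_mul_self {x : FreeGroup α} (hx : x ≠ 1) : x.norm < (x * x).norm := by
  have h1 := FreeGroup.reduceCyclically.conj_conjugator_reduceCyclically x.toWord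
  have h2 := FreeGroup.reduceCyclically.reduce_flatten_replicate_succ
    (FreeGroup.isReduced_toWord (x := x)) 1
  rw [← FreeGroup.toWord_pow, pow_two] at h2
  have h3 := congrArg List.length h1
  have h4 := congrArg List.length h2
  have h5 : FreeGroup.reduceCyclically x.toWord ≠ [] := by
    intro h
    rw [h] at h1
    apply hx
    rw [← FreeGroup.mk_toWord (x := x), ← h1, List.append_nil, ← FreeGroup.mul_mk,
      ← FreeGroup.inv_mk, mul_inv_cancel]
  have h6 := List.length_pos_of_ne_nil h5
  simp [List.replicate_succ] at h3 h4
  simp only [FreeGroup.norm]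
  omega

theorem two_mul_gromovProduct_inv_self_lt {x : FreeGroup α} (hx : x ≠ 1) :
    2 * gromovProduct x⁻¹ x < x.norm := by
  have := norm_mul_add x x
  have := norm_lt_norm_mul_self hx
  omega

/-- A set of elements of a free group that is Nielsen reduced. -/
structure NielsenReduced (X : Set (FreeGroup α)) : Prop where
  inv_mem : ∀ x ∈ X, x⁻¹ ∈ X
  ne_one : ∀ x ∈ X, x ≠ 1
  half : ∀ x ∈ X, ∀ y ∈ X, x * y ≠ 1 → 2 * gromovProduct x⁻¹ y ≤ y.norm
  lt : ∀ x ∈ X, ∀ y ∈ X, ∀ z ∈ X, x * y ≠ 1 → y * z ≠ 1 →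
    gromovProduct x⁻¹ y + gromovProduct y⁻¹ z < y.norm

namespace NielsenReduced

variable {X : Set (FreeGroup α)} (hX : NielsenReduced X)
include hX

/-- The auxiliary left neighbour `z` carries the induction: it sees only the first factor of the
product, because at least one letter of every factor survives the cancellation on both sides. -/
theorem norm_prod_cons (t : List (FreeGroup α)) (x : FreeGroup α) (hmem : ∀ y ∈ x :: t, y ∈ X)
    (hchain : (x :: t).IsChain fun p q => p * q ≠ 1) (z : FreeGroup α) (hz : z ∈ X)
    (hzx : z * x ≠ 1) :
    gromovProduct z⁻¹ (x :: t).prod = gromovProduct z⁻¹ x ∧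
      t.length + gromovProduct z⁻¹ x + 1 ≤ (x :: t).prod.norm := by
  induction t generalizing x z with
  | nil =>
    have h1 := hX.half z hz x (hmem x (by simp)) hzx
    have h2 := norm_pos (hX.ne_one x (hmem x (by simp)))
    simp
    omega
  | cons y t ih =>
    rw [List.isChain_cons_cons] at hchain
    have hx : x ∈ X := hmem x (by simp)
    obtain ⟨h1, h2⟩ := ih y (fun w hw => hmem w (by simp at hw ⊢; tauto)) hchain.2 x hx hchain.1
    have h3 := hX.lt z hz x hx y (hmem y (by simp)) hzx hchain.1
    rw [List.prod_cons]
    set p := (y :: t).prod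
    have h4 := norm_mul_add x p
    have h5 := norm_inv_mul_add x (x * p)
    rw [inv_mul_cancel_left] at h5
    -- By `h4` and `h5`, `x` and `x * p` agree on `|x| - gromovProduct x⁻¹ p` letters, which by `h3`
    -- is more than `z⁻¹` shares with `x`.
    refine ⟨gromovProduct_eq_of_lt ?_, ?_⟩
    · omega
    · simp only [List.length_cons]
      omega

theorem length_le_norm_prod (l : List (FreeGroup α)) (hmem : ∀ y ∈ l, y ∈ X)
    (hchain : l.IsChain fun p q => p * q ≠ 1) : l.length ≤ l.prod.norm := by
  cases l with
  | nil => simp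
  | cons x t =>
    have hx : x ∈ X := hmem x (by simp)
    -- The first factor serves as its own left neighbour, since `x * x ≠ 1`.
    have := (hX.norm_prod_cons t x hmem hchain x hx (fun h => hX.ne_one x hx (by
      have := norm_lt_norm_mul_self (hX.ne_one x hx)
      rw [h, FreeGroup.norm_one] at this
      omega))).2
    simp only [List.length_cons]
    omega

omit hX in
theorem exists_isChain_prod_eq (l : List (FreeGroup α)) (hmem : ∀ y ∈ l, y ∈ X) :
    ∃ m : List (FreeGroup α), (∀ y ∈ m, y ∈ X) ∧ (m.IsChain fun p q => p * q ≠ 1) ∧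
      m.prod = l.prod := by
  induction l with
  | nil => exact ⟨[], by simp, by simp, rfl⟩
  | cons x l ih =>
    obtain ⟨m, h1, h2, h3⟩ := ih fun y hy => hmem y (by simp [hy])
    cases m with
    | nil => exact ⟨[x], by simpa using hmem x (by simp), by simp, by simp [← h3]⟩
    | cons y m =>
      by_cases h : x * y = 1
      · refine ⟨m, fun w hw => h1 w (by simp [hw]), h2.tail, ?_⟩
        rw [List.prod_cons, ← h3, List.prod_cons, ← mul_assoc, h, one_mul]
      · refine ⟨x :: y :: m, ?_, List.isChain_cons_cons.2 ⟨h, h2⟩, by simp [← h3]⟩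
        intro w hw
        rcases List.mem_cons.1 hw with rfl | hw
        · exact hmem _ (by simp)
        · exact h1 w hw

theorem mem_of_norm_eq_one (hgen : Subgroup.closure X = ⊤) (g : FreeGroup α) (hg : g.norm = 1) :
    g ∈ X := by
  have h1 : g ∈ Subgroup.closure X := hgen ▸ Subgroup.mem_top g
  rw [← Subgroup.mem_toSubmonoid, Subgroup.closure_toSubmonoid] at h1
  obtain ⟨l, hl, rfl⟩ := Submonoid.exists_list_of_mem_closure h1
  obtain ⟨m, h2, h3, h4⟩ := exists_isChain_prod_eq (X := X) l (fun y hy => by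
    rcases hl y hy with h | h
    · exact h
    · simpa using hX.inv_mem _ h)
  rw [← h4] at hg ⊢
  have h5 := hX.length_le_norm_prod m h2 h3
  match m, h2, hg, h5 with
  | [], _, hg, _ => simp at hg
  | [x], h2, _, _ => simpa using h2
  | x :: y :: t, _, hg, h5 => simp at h5 hg; omega

end NielsenReduced

/-- If both ends of the middle factor cancel exactly half of it, then a conjugation shortens the
pair. -/
theorem exists_conj_norm_le (x y : FreeGroup α) (k : ℕ) (hk : y.norm = 2 * k)
    (hx : 2 * k ≤ x.norm) (h1 : gromovProduct x⁻¹ y = k) (h2 : gromovProduct y⁻¹ x = k) :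
    ∃ q : FreeGroup α, (q * y * q⁻¹).norm ≤ y.norm ∧ (q * (x * y) * q⁻¹).norm + y.norm ≤ x.norm := by
  have e1 := take_commonPrefixLength x⁻¹.toWord y.toWord
  have e2 := take_commonPrefixLength y⁻¹.toWord x.toWord
  rw [show commonPrefixLength x⁻¹.toWord y.toWord = k from h1] at e1
  rw [show commonPrefixLength y⁻¹.toWord x.toWord = k from h2] at e2
  have hinv : ∀ (w : List (α × Bool)), (FreeGroup.invRev w).take k =
      FreeGroup.invRev (w.drop (w.length - k)) := by
    intro w
    simp [FreeGroup.invRev, List.take_reverse, ← List.map_drop]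
  rw [FreeGroup.toWord_inv, hinv] at e1 e2
  -- The overlaps force `y = P Q⁻¹` and `x = Q R P⁻¹` without cancellation. Conjugation by `Q⁻¹`
  -- turns `y` into `Q⁻¹ P` and `x y` into `R`, of length at most `|x| - 2k`.
  set P := y.toWord.take k with hP
  set Q := x.toWord.take k with hQ
  have ly : y.toWord.length = 2 * k := hk
  have lx : 2 * k ≤ x.toWord.length := hx
  have hy : y = FreeGroup.mk P * (FreeGroup.mk Q)⁻¹ := by
    rw [FreeGroup.inv_mk, FreeGroup.mul_mk, ← e2, FreeGroup.invRev_invRev, ly,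
      show 2 * k - k = k by omega, List.take_append_drop, FreeGroup.mk_toWord]
  set R := (x.toWord.drop k).take (x.toWord.length - 2 * k) with hR
  have hxw : x = FreeGroup.mk Q * FreeGroup.mk R * (FreeGroup.mk P)⁻¹ := by
    have : (x.toWord.drop k).drop (x.toWord.length - 2 * k) =
        x.toWord.drop (x.toWord.length - k) := by
      rw [List.drop_drop]; congr 1; omega
    rw [FreeGroup.inv_mk, FreeGroup.mul_mk, FreeGroup.mul_mk, ← e1, FreeGroup.invRev_invRev,
      List.append_assoc, ← this, List.take_append_drop, List.take_append_drop, FreeGroup.mk_toWord]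
  refine ⟨(FreeGroup.mk Q)⁻¹, ?_, ?_⟩
  · have : (FreeGroup.mk Q)⁻¹ * y * (FreeGroup.mk Q)⁻¹⁻¹ =
        FreeGroup.mk (FreeGroup.invRev Q ++ P) := by
      rw [← FreeGroup.mul_mk, ← FreeGroup.inv_mk, hy]; group
    rw [this, hk]
    refine FreeGroup.norm_mk_le.trans ?_
    simp [P, Q]
    omega
  · have : (FreeGroup.mk Q)⁻¹ * (x * y) * (FreeGroup.mk Q)⁻¹⁻¹ = FreeGroup.mk R := by
      rw [hxw, hy]; group
    rw [this, hk]
    have h3 : (FreeGroup.mk R).norm ≤ _ := FreeGroup.norm_mk_le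
    have h4 : R.length ≤ x.toWord.length - 2 * k := by simp [R]
    simp only [FreeGroup.norm] at h3 ⊢
    omega

end Gromov

/-! ### Shortest pairs are Nielsen reduced -/

section Nielsen

variable {α : Type*} [DecidableEq α]

/-- A set of pairs that is closed under the Nielsen moves and simultaneous conjugation. -/
structure NielsenClosed {G : Type*} [Group G] (S : Set (G × G)) : Prop where
  swap : ∀ {x y}, (x, y) ∈ S → (y, x) ∈ S
  inv : ∀ {x y}, (x, y) ∈ S → (x⁻¹, y) ∈ S
  mul : ∀ {x y}, (x, y) ∈ S → (x, x * y) ∈ S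
  conj : ∀ {x y} (q), (x, y) ∈ S → (q * x * q⁻¹, q * y * q⁻¹) ∈ S

/-- A pair in `S` of minimal total length. -/
def IsShortest (S : Set (FreeGroup α × FreeGroup α)) (x y : FreeGroup α) : Prop :=
  (x, y) ∈ S ∧ ∀ p ∈ S, x.norm + y.norm ≤ p.1.norm + p.2.norm

namespace IsShortest

variable {S : Set (FreeGroup α × FreeGroup α)} (hS : NielsenClosed S) {x y : FreeGroup α}
include hS

theorem swap (h : IsShortest S x y) : IsShortest S y x :=
  ⟨hS.swap h.1, fun p hp => (add_comm y.norm x.norm).le.trans (h.2 p hp)⟩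

theorem inv_left (h : IsShortest S x y) : IsShortest S x⁻¹ y :=
  ⟨hS.inv h.1, fun p hp => by rw [FreeGroup.norm_inv_eq]; exact h.2 p hp⟩

theorem inv_right (h : IsShortest S x y) : IsShortest S x y⁻¹ :=
  ((h.swap hS).inv_left hS).swap hS

/-- Otherwise the move `y ↦ x y` would shorten the pair. -/
theorem two_mul_gromovProduct_le_left (h : IsShortest S x y) :
    2 * gromovProduct x⁻¹ y ≤ x.norm := by
  have h1 := h.2 _ (hS.mul h.1)
  have h2 := norm_mul_add x y
  simp only at h1
  omega

theorem two_mul_gromovProduct_le_right (h : IsShortest S x y) :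
    2 * gromovProduct x⁻¹ y ≤ y.norm := by
  have h1 := two_mul_gromovProduct_le_left hS (((h.inv_left hS).inv_right hS).swap hS)
  rwa [inv_inv, gromovProduct_comm, FreeGroup.norm_inv_eq] at h1

/-- Each end cancels at most half of `y`, so failure means exactly half at both ends. Then a
conjugate of `(y, x y)` has total length at most `|x|`, against minimality. -/
theorem gromovProduct_add_lt (h : IsShortest S x y) (hy : y ≠ 1) :
    gromovProduct x⁻¹ y + gromovProduct y⁻¹ x < y.norm := by
  by_contra hlt
  have h1 := h.two_mul_gromovProduct_le_right hS
  have h2 := (h.swap hS).two_mul_gromovProduct_le_left hS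
  have h3 := h.two_mul_gromovProduct_le_left hS
  obtain ⟨q, h4, h5⟩ := exists_conj_norm_le x y (gromovProduct x⁻¹ y) (by omega) (by omega) rfl
    (by omega)
  have h7 : (y, x * y) ∈ S := by
    have hinv : ∀ {p q}, (p, q) ∈ S → (p, q⁻¹) ∈ S := fun hpq => hS.swap (hS.inv (hS.swap hpq))
    simpa using hinv (hS.inv (hS.mul (hinv (hS.inv (hS.swap h.1)))))
  have h8 := h.2 _ (hS.conj q h7)
  have h9 := norm_pos hy
  simp only at h8
  omega

/-- If both ends cancelled half of `y`, then `x⁻¹` would share half of `y` with both `y` and `y⁻¹`.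
By the ultrametric inequality these would share half with each other, whereas `y * y` cancels less.
-/
theorem gromovProduct_add_inv_lt (h : IsShortest S x y) (hy : y ≠ 1) :
    gromovProduct x⁻¹ y + gromovProduct y⁻¹ x⁻¹ < y.norm := by
  have h1 := h.two_mul_gromovProduct_le_right hS
  have h2 := ((h.swap hS).inv_right hS).two_mul_gromovProduct_le_left hS
  have h3 := min_gromovProduct_le y⁻¹ x⁻¹ y
  have h4 := two_mul_gromovProduct_inv_self_lt hy
  omega

theorem nielsenReduced (h : IsShortest S x y) (hx : x ≠ 1) (hy : y ≠ 1) :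
    NielsenReduced ({x, x⁻¹, y, y⁻¹} : Set (FreeGroup α)) := by
  have hne : ∀ p ∈ ({x, x⁻¹, y, y⁻¹} : Set (FreeGroup α)), p ≠ 1 := by
    rintro p (rfl | rfl | rfl | rfl) <;> simpa
  have hpair : ∀ p ∈ ({x, x⁻¹, y, y⁻¹} : Set (FreeGroup α)),
      ∀ q ∈ ({x, x⁻¹, y, y⁻¹} : Set (FreeGroup α)), p * q ≠ 1 → p = q ∨ IsShortest S p q := by
    have h1 := h.inv_left hS
    have h2 := h.inv_right hS
    have h3 := h1.inv_right hS
    have h4 := h.swap hS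
    have h5 := h1.swap hS
    have h6 := h2.swap hS
    have h7 := h3.swap hS
    rintro p (rfl | rfl | rfl | rfl) q (rfl | rfl | rfl | rfl) hpq <;> simp_all
  have hleft : ∀ p ∈ ({x, x⁻¹, y, y⁻¹} : Set (FreeGroup α)),
      ∀ q ∈ ({x, x⁻¹, y, y⁻¹} : Set (FreeGroup α)), p * q ≠ 1 →
        2 * gromovProduct p⁻¹ q ≤ p.norm := by
    intro p hp q hq hpq
    rcases hpair p hp q hq hpq with rfl | h'
    · exact (two_mul_gromovProduct_inv_self_lt (hne p hp)).le
    · exact h'.two_mul_gromovProduct_le_left hS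
  have hright : ∀ p ∈ ({x, x⁻¹, y, y⁻¹} : Set (FreeGroup α)),
      ∀ q ∈ ({x, x⁻¹, y, y⁻¹} : Set (FreeGroup α)), p * q ≠ 1 →
        2 * gromovProduct p⁻¹ q ≤ q.norm := by
    intro p hp q hq hpq
    rcases hpair p hp q hq hpq with rfl | h'
    · exact (two_mul_gromovProduct_inv_self_lt (hne p hp)).le
    · exact h'.two_mul_gromovProduct_le_right hS
  -- Only two generators are available, so once equal neighbours are set aside the outer factors are
  -- `p` and `p^{±1}`.
  have hsame : ∀ p ∈ ({x, x⁻¹, y, y⁻¹} : Set (FreeGroup α)),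
      ∀ q ∈ ({x, x⁻¹, y, y⁻¹} : Set (FreeGroup α)),
      ∀ r ∈ ({x, x⁻¹, y, y⁻¹} : Set (FreeGroup α)), p * q ≠ 1 → q * r ≠ 1 →
        p = q ∨ q = r ∨ r = p ∨ r = p⁻¹ := by
    rintro p (rfl | rfl | rfl | rfl) q (rfl | rfl | rfl | rfl) r (rfl | rfl | rfl | rfl) hpq hqr <;>
      simp at hpq hqr ⊢
  refine ⟨?_, hne, hright, ?_⟩
  · rintro p (rfl | rfl | rfl | rfl) <;> simp
  · intro p hp q hq r hr hpq hqr
    have h1 := hright p hp q hq hpq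
    have h2 := hleft q hq r hr hqr
    rcases eq_or_ne p q with rfl | hne1
    · have := two_mul_gromovProduct_inv_self_lt (hne p hp)
      omega
    rcases eq_or_ne q r with rfl | hne2
    · have := two_mul_gromovProduct_inv_self_lt (hne q hq)
      omega
    have h3 := (hpair p hp q hq hpq).resolve_left hne1
    rcases hsame p hp q hq r hr hpq hqr with h | h | rfl | rfl
    · exact absurd h hne1
    · exact absurd h hne2
    · exact h3.gromovProduct_add_lt hS (hne q hq)
    · exact h3.gromovProduct_add_inv_lt hS (hne q hq)

end IsShortest

/-- Every nonempty set of generating pairs of `F(a, b)` that is closed under Nielsen moves and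
conjugation contains the standard basis. -/
theorem NielsenClosed.of_mem {S : Set (FreeGroup (Fin 2) × FreeGroup (Fin 2))}
    (hS : NielsenClosed S) (hne : S.Nonempty) (hone : ∀ p ∈ S, p.1 ≠ 1)
    (hgen : ∀ p ∈ S, Subgroup.closure {p.1, p.2} = ⊤) :
    (FreeGroup.of 0, FreeGroup.of 1) ∈ S := by
  obtain ⟨⟨x, y⟩, hxy, hmin⟩ := exists_minimalFor_of_wellFoundedLT (· ∈ S)
    (fun p : FreeGroup (Fin 2) × FreeGroup (Fin 2) => p.1.norm + p.2.norm) hne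
  have h : IsShortest S x y := ⟨hxy, fun p hp => by
    rcases le_total (x.norm + y.norm) (p.1.norm + p.2.norm) with h | h
    · exact h
    · exact hmin hp h⟩
  have hred := h.nielsenReduced hS (hone _ hxy) (hone _ (hS.swap hxy))
  have htop : Subgroup.closure ({x, x⁻¹, y, y⁻¹} : Set (FreeGroup (Fin 2))) = ⊤ :=
    top_le_iff.1 ((hgen _ hxy).ge.trans (Subgroup.closure_mono (by
      rintro p (rfl | rfl) <;> simp)))
  have h0 := hred.mem_of_norm_eq_one htop (FreeGroup.of 0) (FreeGroup.norm_of 0)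
  have h1 := hred.mem_of_norm_eq_one htop (FreeGroup.of 1) (FreeGroup.norm_of 1)
  have hd1 : (FreeGroup.of 0 : FreeGroup (Fin 2)) ≠ FreeGroup.of 1 := by decide
  have hd2 : (FreeGroup.of 0 : FreeGroup (Fin 2)) ≠ (FreeGroup.of 1)⁻¹ := by decide
  have hxy1 := hS.inv hxy
  have hxy2 := hS.swap (hS.inv (hS.swap hxy))
  have hxy3 := hS.swap (hS.inv (hS.swap hxy1))
  have hyx := hS.swap hxy
  have hyx1 := hS.swap hxy1
  have hyx2 := hS.swap hxy2
  have hyx3 := hS.swap hxy3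
  simp only [mem_insert_iff, mem_singleton_iff] at h0 h1
  rcases h0 with h0 | h0 | h0 | h0 <;> rcases h1 with h1 | h1 | h1 | h1 <;> rw [h0, h1] at hd1 hd2 ⊢ <;>
    simp_all

end Nielsen

/-! ### Automorphisms of the free group of rank two and its primitive classes -/

section Automorphisms

/-- The free group of rank two. -/
abbrev F₂ : Type := FreeGroup (Fin 2)

/-- The first generator. -/
abbrev genA : F₂ := FreeGroup.of 0

/-- The second generator. -/
abbrev genB : F₂ := FreeGroup.of 1

theorem mulAut_ext {φ ψ : MulAut F₂} (ha : φ genA = ψ genA) (hb : φ genB = ψ genB) : φ = ψ := by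
  have : φ.toMonoidHom = ψ.toMonoidHom := by
    ext i
    fin_cases i
    · exact ha
    · exact hb
  exact MulEquiv.toMonoidHom_injective this

/-- The automorphism of `F₂` with given images of the generators and of their preimages. -/
def mkAut (x y x' y' : F₂) (h1 : FreeGroup.lift ![x', y'] x = genA)
    (h2 : FreeGroup.lift ![x', y'] y = genB) (h3 : FreeGroup.lift ![x, y] x' = genA)
    (h4 : FreeGroup.lift ![x, y] y' = genB) : MulAut F₂ :=
  MonoidHom.toMulEquiv (FreeGroup.lift ![x, y]) (FreeGroup.lift ![x', y'])
    (by ext i; fin_cases i <;> simp [h1, h2]) (by ext i; fin_cases i <;> simp [h3, h4])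

/-- The automorphism that exchanges the generators. -/
def swapAut : MulAut F₂ := mkAut genB genA genB genA (by simp) (by simp) (by simp) (by simp)

/-- The automorphism that inverts the first generator. -/
def invAut : MulAut F₂ :=
  mkAut genA⁻¹ genB genA⁻¹ genB (by simp) (by simp) (by simp) (by simp)

/-- The transvection `b ↦ ab`. -/
def transB : MulAut F₂ :=
  mkAut genA (genA * genB) genA (genA⁻¹ * genB) (by simp) (by simp) (by simp) (by simp)

/-- The transvection `a ↦ ba`. -/
def transA : MulAut F₂ :=
  mkAut (genB * genA) genB (genB⁻¹ * genA) genB (by simp) (by simp) (by simp) (by simp)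

@[simp] theorem swapAut_a : swapAut genA = genB := by simp [swapAut, mkAut]
@[simp] theorem swapAut_b : swapAut genB = genA := by simp [swapAut, mkAut]
@[simp] theorem invAut_a : invAut genA = genA⁻¹ := by simp [invAut, mkAut]
@[simp] theorem invAut_b : invAut genB = genB := by simp [invAut, mkAut]
@[simp] theorem transB_a : transB genA = genA := by simp [transB, mkAut]
@[simp] theorem transB_b : transB genB = genA * genB := by simp [transB, mkAut]
@[simp] theorem transA_a : transA genA = genB * genA := by simp [transA, mkAut]
@[simp] theorem transA_b : transA genB = genB := by simp [transA, mkAut]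

@[simp] theorem transB_symm_a : MulEquiv.symm transB genA = genA := by
  rw [MulEquiv.symm_apply_eq, transB_a]
@[simp] theorem transB_symm_b : MulEquiv.symm transB genB = genA⁻¹ * genB := by
  rw [MulEquiv.symm_apply_eq]; simp
@[simp] theorem transA_symm_a : MulEquiv.symm transA genA = genB⁻¹ * genA := by
  rw [MulEquiv.symm_apply_eq]; simp
@[simp] theorem transA_symm_b : MulEquiv.symm transA genB = genB := by
  rw [MulEquiv.symm_apply_eq, transA_b]

/-- The letters of `F₂`. -/
def letters : Set F₂ := {genA, genA⁻¹, genB, genB⁻¹}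

/-- An automorphism that permutes the letters. -/
def IsSignedPerm (φ : MulAut F₂) : Prop := φ genA ∈ letters ∧ φ genB ∈ letters

theorem IsSignedPerm.map_letter {φ : MulAut F₂} (h : IsSignedPerm φ) {x : F₂} (hx : x ∈ letters) :
    φ x ∈ letters := by
  have hinv : ∀ y ∈ letters, y⁻¹ ∈ letters := by
    rintro y (rfl | rfl | rfl | rfl) <;> simp [letters]
  rcases hx with rfl | rfl | rfl | rfl
  · exact h.1
  · rw [map_inv]; exact hinv _ h.1
  · exact h.2
  · rw [map_inv]; exact hinv _ h.2

theorem IsSignedPerm.mul {φ ψ : MulAut F₂} (hφ : IsSignedPerm φ) (hψ : IsSignedPerm ψ) :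
    IsSignedPerm (φ * ψ) :=
  ⟨hφ.map_letter hψ.1, hφ.map_letter hψ.2⟩

theorem isSignedPerm_one : IsSignedPerm 1 := by simp [IsSignedPerm, letters]

theorem isSignedPerm_swapAut : IsSignedPerm swapAut := by simp [IsSignedPerm, letters]

theorem isSignedPerm_invAut : IsSignedPerm invAut := by simp [IsSignedPerm, letters]

theorem IsSignedPerm.cases {φ : MulAut F₂} (h : IsSignedPerm φ) :
    ((φ genA = genA ∨ φ genA = genA⁻¹) ∧ (φ genB = genB ∨ φ genB = genB⁻¹)) ∨
      ((φ genA = genB ∨ φ genA = genB⁻¹) ∧ (φ genB = genA ∨ φ genB = genA⁻¹)) := by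
  have h1 : φ genA ≠ φ genB := φ.injective.ne (by decide)
  have h2 : φ genA ≠ (φ genB)⁻¹ := by
    rw [← map_inv]; exact φ.injective.ne (by decide)
  obtain ⟨ha, hb⟩ := h
  rcases ha with ha | ha | ha | ha <;> rcases hb with hb | hb | hb | hb <;> rw [ha, hb] at h1 h2 ⊢ <;>
    simp at h1 h2 ⊢

/-- Automorphisms in the monoid generated by the two transvections. -/
inductive IsPositive : MulAut F₂ → Prop
  | one : IsPositive 1
  | mul_transA {φ} : IsPositive φ → IsPositive (φ * transA)
  | mul_transB {φ} : IsPositive φ → IsPositive (φ * transB)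

/-- The transvections and their inverses. -/
def transvections : Set (MulAut F₂) := {transA, transA⁻¹, transB, transB⁻¹}

/-- A signed permutation conjugates a left transvection to a left or right one; the right ones
become left ones after an inner automorphism, whence `k`. -/
theorem IsSignedPerm.mul_transB_inv {φ : MulAut F₂} (h : IsSignedPerm φ) :
    ∃ k, ∃ τ ∈ transvections, φ * transB⁻¹ = MulAut.conj k * τ * φ := by
  rcases h.cases with ⟨ha | ha, hb | hb⟩ | ⟨ha | ha, hb | hb⟩
  · exact ⟨1, transB⁻¹, by simp [transvections], mulAut_ext (by simp [ha]) (by simp [ha, hb])⟩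
  · exact ⟨genA⁻¹, transB, by simp [transvections], mulAut_ext (by simp [ha]) (by simp [ha, hb, mul_assoc])⟩
  · exact ⟨1, transB, by simp [transvections], mulAut_ext (by simp [ha]) (by simp [ha, hb])⟩
  · exact ⟨genA, transB⁻¹, by simp [transvections], mulAut_ext (by simp [ha]) (by simp [ha, hb, mul_assoc])⟩
  · exact ⟨1, transA⁻¹, by simp [transvections], mulAut_ext (by simp [ha]) (by simp [ha, hb])⟩
  · exact ⟨genB⁻¹, transA, by simp [transvections], mulAut_ext (by simp [ha]) (by simp [ha, hb, mul_assoc])⟩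
  · exact ⟨1, transA, by simp [transvections], mulAut_ext (by simp [ha]) (by simp [ha, hb])⟩
  · exact ⟨genB, transA⁻¹, by simp [transvections], mulAut_ext (by simp [ha]) (by simp [ha, hb, mul_assoc])⟩

theorem mul_conj_aut {G : Type*} [Group G] (φ : MulAut G) (k : G) :
    φ * MulAut.conj k = MulAut.conj (φ k) * φ := by
  ext x
  simp

/-- `φ` is the product of a signed permutation, a positive automorphism and a signed permutation,
up to an inner automorphism. -/
def IsEuclidean (φ : MulAut F₂) : Prop :=
  ∃ k σ μ σ', IsSignedPerm σ ∧ IsPositive μ ∧ IsSignedPerm σ' ∧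
    φ = MulAut.conj k * σ * μ * σ'

theorem IsPositive.mul_transvection {μ : MulAut F₂} (h : IsPositive μ) {τ : MulAut F₂}
    (hτ : τ ∈ transvections) : IsEuclidean (μ * τ) := by
  have hmk : ∀ {ν}, IsPositive ν → IsEuclidean ν := fun {ν} hν =>
    ⟨1, 1, ν, 1, isSignedPerm_one, hν, isSignedPerm_one, by simp⟩
  have hs := isSignedPerm_swapAut
  have hi := isSignedPerm_invAut
  rcases hτ with rfl | rfl | rfl | rfl
  · exact hmk h.mul_transA
  · cases h with
    | one =>
      refine ⟨1, swapAut * invAut * swapAut, transA, swapAut * invAut * swapAut, (hs.mul hi).mul hs,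
        ?_, (hs.mul hi).mul hs, mulAut_ext (by simp) (by simp)⟩
      simpa using IsPositive.one.mul_transA
    | @mul_transA ν hν => simpa [mul_assoc] using hmk hν
    -- Up to conjugation by `b⁻¹`, `transB * transA⁻¹` is `transA` times a signed permutation, so
    -- the inverse disappears.
    | @mul_transB ν hν =>
      refine ⟨ν genB⁻¹, 1, ν * transA, swapAut * invAut, isSignedPerm_one, hν.mul_transA,
        hs.mul hi, ?_⟩
      rw [mul_one, ← mul_assoc (MulAut.conj _) ν, ← mul_conj_aut]
      simp only [mul_assoc]
      congr 1
      exact mulAut_ext (by simp) (by simp)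
  · exact hmk h.mul_transB
  · cases h with
    | one =>
      refine ⟨1, invAut, transB, invAut, hi, ?_, hi, mulAut_ext (by simp) (by simp)⟩
      simpa using IsPositive.one.mul_transB
    | @mul_transB ν hν => simpa [mul_assoc] using hmk hν
    | @mul_transA ν hν =>
      refine ⟨ν genA⁻¹, 1, ν * transB, invAut * swapAut, isSignedPerm_one, hν.mul_transB,
        hi.mul hs, ?_⟩
      rw [mul_one, ← mul_assoc (MulAut.conj _) ν, ← mul_conj_aut]
      simp only [mul_assoc]
      congr 1
      exact mulAut_ext (by simp) (by simp)

namespace IsEuclidean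

theorem conj_mul {φ : MulAut F₂} (h : IsEuclidean φ) (k : F₂) :
    IsEuclidean (MulAut.conj k * φ) := by
  obtain ⟨l, σ, μ, σ', h1, h2, h3, rfl⟩ := h
  exact ⟨k * l, σ, μ, σ', h1, h2, h3, by simp [mul_assoc]⟩

theorem mul_signedPerm {φ σ : MulAut F₂} (h : IsEuclidean φ) (hσ : IsSignedPerm σ) :
    IsEuclidean (φ * σ) := by
  obtain ⟨l, σ₁, μ, σ₂, h1, h2, h3, rfl⟩ := h
  exact ⟨l, σ₁, μ, σ₂ * σ, h1, h2, h3.mul hσ, by simp [mul_assoc]⟩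

theorem signedPerm_mul {φ σ : MulAut F₂} (h : IsEuclidean φ) (hσ : IsSignedPerm σ) :
    IsEuclidean (σ * φ) := by
  obtain ⟨l, σ₁, μ, σ₂, h1, h2, h3, rfl⟩ := h
  refine ⟨σ l, σ * σ₁, μ, σ₂, hσ.mul h1, h2, h3, ?_⟩
  rw [← mul_assoc (MulAut.conj (σ l)), ← mul_conj_aut]
  simp only [mul_assoc]

theorem mul_transB_inv {φ : MulAut F₂} (h : IsEuclidean φ) : IsEuclidean (φ * transB⁻¹) := by
  obtain ⟨l, σ₁, μ, σ₂, h1, h2, h3, rfl⟩ := h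
  obtain ⟨k, τ, hτ, hk⟩ := h3.mul_transB_inv
  have h4 := (((((h2.mul_transvection hτ).conj_mul (μ k)).signedPerm_mul h1).conj_mul
    l).mul_signedPerm h3)
  convert h4 using 1
  rw [← mul_assoc (MulAut.conj (μ k)), ← mul_conj_aut, mul_assoc _ σ₂, hk]
  simp only [mul_assoc]

end IsEuclidean

theorem closure_map_generators (φ : MulAut F₂) :
    Subgroup.closure ({φ genA, φ genB} : Set F₂) = ⊤ := by
  have h1 : ({φ genA, φ genB} : Set F₂) = φ.toMonoidHom '' range FreeGroup.of := by
    ext x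
    simp [eq_comm]
  rw [h1, ← MonoidHom.map_closure, FreeGroup.closure_range_of, ← MonoidHom.range_eq_map]
  exact MonoidHom.range_eq_top.2 φ.surjective

theorem isEuclidean (φ : MulAut F₂) : IsEuclidean φ := by
  -- Bases from which the Euclidean form can be carried back to `φ`. Descent reaches the standard
  -- basis, where the form is trivial.
  let S : Set (F₂ × F₂) :=
    {p | ∃ ψ : MulAut F₂, ψ genA = p.1 ∧ ψ genB = p.2 ∧ (IsEuclidean ψ → IsEuclidean φ)}
  have hS : NielsenClosed S := by
    refine ⟨?_, ?_, ?_, ?_⟩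
    · rintro _ _ ⟨ψ, rfl, rfl, h⟩
      refine ⟨ψ * swapAut, by simp, by simp, fun h' => h ?_⟩
      have := h'.mul_signedPerm isSignedPerm_swapAut
      rwa [mul_assoc, show swapAut * swapAut = 1 from mulAut_ext (by simp) (by simp),
        mul_one] at this
    · rintro _ _ ⟨ψ, rfl, rfl, h⟩
      refine ⟨ψ * invAut, by simp, by simp, fun h' => h ?_⟩
      have := h'.mul_signedPerm isSignedPerm_invAut
      rwa [mul_assoc, show invAut * invAut = 1 from mulAut_ext (by simp) (by simp),
        mul_one] at this
    · rintro _ _ ⟨ψ, rfl, rfl, h⟩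
      refine ⟨ψ * transB, by simp, by simp, fun h' => h ?_⟩
      simpa using h'.mul_transB_inv
    · rintro _ _ k ⟨ψ, rfl, rfl, h⟩
      refine ⟨MulAut.conj k * ψ, by simp, by simp, fun h' => h ?_⟩
      simpa [← mul_assoc] using h'.conj_mul k⁻¹
  obtain ⟨ψ, h1, h2, h3⟩ := hS.of_mem ⟨(φ genA, φ genB), φ, rfl, rfl, id⟩
    (by
      rintro _ ⟨ψ, h1, -, -⟩
      rw [← h1]
      simp)
    (by
      rintro _ ⟨ψ, h1, h2, -⟩
      rw [← h1, ← h2]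
      exact closure_map_generators ψ)
  obtain rfl : ψ = 1 := mulAut_ext h1 h2
  exact h3 ⟨1, 1, 1, 1, isSignedPerm_one, .one, isSignedPerm_one, by simp⟩

/-- The abelianization of `F₂`. -/
def exponents : F₂ →* Multiplicative (ℤ × ℤ) :=
  FreeGroup.lift ![Multiplicative.ofAdd (1, 0), Multiplicative.ofAdd (0, 1)]

/-- The exponent sum of the first generator. -/
def expA (x : F₂) : ℤ := (exponents x).toAdd.1

/-- The exponent sum of the second generator. -/
def expB (x : F₂) : ℤ := (exponents x).toAdd.2

@[simp] theorem expA_mul (x y : F₂) : expA (x * y) = expA x + expA y := by simp [expA]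
@[simp] theorem expB_mul (x y : F₂) : expB (x * y) = expB x + expB y := by simp [expB]
@[simp] theorem expA_inv (x : F₂) : expA x⁻¹ = -expA x := by simp [expA]
@[simp] theorem expB_inv (x : F₂) : expB x⁻¹ = -expB x := by simp [expB]
@[simp] theorem expA_one : expA 1 = 0 := by simp [expA]
@[simp] theorem expB_one : expB 1 = 0 := by simp [expB]
@[simp] theorem expA_a : expA genA = 1 := by simp [expA, exponents]
@[simp] theorem expB_a : expB genA = 0 := by simp [expB, exponents]
@[simp] theorem expA_b : expA genB = 0 := by simp [expA, exponents]
@[simp] theorem expB_b : expB genB = 1 := by simp [expB, exponents]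

theorem exponents_map (φ : F₂ →* F₂) (x : F₂) :
    exponents (φ x) = exponents (φ genA) ^ expA x * exponents (φ genB) ^ expB x := by
  induction x using FreeGroup.induction_on with
  | C1 => simp
  | of i => fin_cases i <;> simp
  | inv_of i _ => fin_cases i <;> simp
  | mul x y hx hy =>
    rw [map_mul, map_mul, hx, hy, expA_mul, expB_mul, zpow_add, zpow_add]
    exact mul_mul_mul_comm _ _ _ _

theorem expA_map (φ : F₂ →* F₂) (x : F₂) :
    expA (φ x) = expA x * expA (φ genA) + expB x * expA (φ genB) := by
  simp [expA, exponents_map φ x]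

theorem expB_map (φ : F₂ →* F₂) (x : F₂) :
    expB (φ x) = expA x * expB (φ genA) + expB x * expB (φ genB) := by
  simp [expB, exponents_map φ x]

theorem IsPositive.exponents_nonneg {μ : MulAut F₂} (h : IsPositive μ) :
    (0 ≤ expA (μ genA) ∧ 0 ≤ expB (μ genA) ∧ 1 ≤ expA (μ genA) + expB (μ genA)) ∧
      (0 ≤ expA (μ genB) ∧ 0 ≤ expB (μ genB) ∧ 1 ≤ expA (μ genB) + expB (μ genB)) := by
  induction h with
  | one => simp
  | mul_transA _ ih => simp; omega
  | mul_transB _ ih => simp; omega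

/-- Each transvection replaces one column of the matrix by the sum of both, making its entry sum at
least two, and keeps the image of the other generator. -/
theorem IsPositive.mem_letters {μ : MulAut F₂} (h : IsPositive μ) :
    (expA (μ genA) + expB (μ genA) ≤ 1 → μ genA ∈ letters) ∧
      (expA (μ genB) + expB (μ genB) ≤ 1 → μ genB ∈ letters) := by
  induction h with
  | one => simp [letters]
  | @mul_transA ν hν ih =>
    have := hν.exponents_nonneg
    refine ⟨fun h => ?_, fun h => ?_⟩
    · simp at h
      omega
    · simpa using ih.2 (by simpa using h)
  | @mul_transB ν hν ih =>
    have := hν.exponents_nonneg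
    refine ⟨fun h => ?_, fun h => ?_⟩
    · simpa using ih.1 (by simpa using h)
    · simp at h
      omega

theorem inv_mem_letters {x : F₂} : x⁻¹ ∈ letters ↔ x ∈ letters := by
  simp only [letters, mem_insert_iff, mem_singleton_iff, inv_eq_iff_eq_inv, inv_inv]
  tauto

theorem IsPositive.map_letter_mem_letters {μ : MulAut F₂} (h : IsPositive μ) {x : F₂}
    (hx : x ∈ letters) (hn : |expA (μ x)| + |expB (μ x)| ≤ 1) : μ x ∈ letters := by
  have h0 := h.exponents_nonneg
  have key : ∀ y, (y = genA ∨ y = genB) → |expA (μ y)| + |expB (μ y)| ≤ 1 → μ y ∈ letters := by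
    rintro y (rfl | rfl) hn
    · exact h.mem_letters.1 (le_trans (add_le_add (le_abs_self _) (le_abs_self _)) hn)
    · exact h.mem_letters.2 (le_trans (add_le_add (le_abs_self _) (le_abs_self _)) hn)
  rcases hx with rfl | rfl | rfl | rfl
  · exact key _ (.inl rfl) hn
  · rw [map_inv, inv_mem_letters]
    exact key _ (.inl rfl) (by simpa using hn)
  · exact key _ (.inr rfl) hn
  · rw [map_inv, inv_mem_letters]
    exact key _ (.inr rfl) (by simpa using hn)

theorem IsSignedPerm.abs_exponents {σ : MulAut F₂} (h : IsSignedPerm σ) (x : F₂) :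
    |expA (σ x)| + |expB (σ x)| = |expA x| + |expB x| := by
  have h1 := expA_map σ.toMonoidHom x
  have h2 := expB_map σ.toMonoidHom x
  simp only [MulEquiv.toMonoidHom_eq_coe, MonoidHom.coe_coe] at h1 h2
  rw [h1, h2]
  rcases h.cases with ⟨ha | ha, hb | hb⟩ | ⟨ha | ha, hb | hb⟩ <;> simp [ha, hb, add_comm]

/-- Signed permutations preserve the ℓ¹ norm of the exponents, so the positive part sends a letter
to a vector of norm one, hence to a letter. Among the letters only `a` has exponents `(1, 0)`. -/
theorem isConj_of_exponents_eq (φ : MulAut F₂) (h1 : expA (φ genA) = 1) (h2 : expB (φ genA) = 0) :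
    IsConj genA (φ genA) := by
  obtain ⟨k, σ, μ, σ', hσ, hμ, hσ', rfl⟩ := isEuclidean φ
  set y := σ (μ (σ' genA)) with hy
  have h3 : (MulAut.conj k * σ * μ * σ') genA = k * y * k⁻¹ := by simp [hy]
  rw [h3] at h1 h2 ⊢
  simp only [expA_mul, expA_inv, expB_mul, expB_inv] at h1 h2
  have h4 : |expA y| + |expB y| = 1 := by
    rw [show expA y = 1 by omega, show expB y = 0 by omega]; simp
  have h5 : y ∈ letters := hσ.map_letter (hμ.map_letter_mem_letters hσ'.1
    (by rw [← hσ.abs_exponents]; exact h4.le))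
  have h6 : y = genA := by
    rcases h5 with h | h | h | h <;> rw [h] at h1 h2 <;> simp at h1 h2
    exact h
  rw [h6]
  exact isConj_iff.2 ⟨k, rfl⟩

theorem IsPrimitive.exists_mulAut {g : F₂} (hg : IsPrimitive g) : ∃ φ : MulAut F₂, φ genA = g := by
  classical
  obtain ⟨ι, b, i, rfl⟩ := hg
  let e : ι ≃ Fin 2 := Equiv.ofFreeGroupEquiv b.repr.symm
  -- The swap puts the chosen basis element at index `0`.
  let e' : ι ≃ Fin 2 := e.trans (Equiv.swap (e i) 0)
  refine ⟨(b.reindex e').repr.symm, ?_⟩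
  have : (b.reindex e') 0 = b i := by
    rw [FreeGroupBasis.reindex_apply]
    congr 1
    simp [e']
  rw [← this]
  rfl

theorem isPrimitive_map (φ : MulAut F₂) (i : Fin 2) : IsPrimitive (φ (FreeGroup.of i)) :=
  ⟨Fin 2, (FreeGroupBasis.ofFreeGroup (Fin 2)).map φ, i, by simp⟩

/-- Primitive elements of `F₂` with the same abelianization are conjugate. -/
theorem IsPrimitive.isConj {g h : F₂} (hg : IsPrimitive g) (hh : IsPrimitive h)
    (hA : expA g = expA h) (hB : expB g = expB h) : IsConj g h := by
  obtain ⟨φ, rfl⟩ := hg.exists_mulAut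
  obtain ⟨ψ, rfl⟩ := hh.exists_mulAut
  have h1 : ∀ x y : F₂, expA x = expA y → expB x = expB y →
      expA (φ⁻¹ x) = expA (φ⁻¹ y) ∧ expB (φ⁻¹ x) = expB (φ⁻¹ y) := by
    intro x y h1 h2
    have h3 := expA_map (φ⁻¹ : MulAut F₂).toMonoidHom
    have h4 := expB_map (φ⁻¹ : MulAut F₂).toMonoidHom
    simp only [MulEquiv.toMonoidHom_eq_coe, MonoidHom.coe_coe] at h3 h4
    rw [h3 x, h3 y, h4 x, h4 y, h1, h2]
    exact ⟨rfl, rfl⟩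
  obtain ⟨h2, h3⟩ := h1 _ _ hA hB
  have h4 := isConj_of_exponents_eq (φ⁻¹ * ψ) (by simpa using h2.symm) (by simpa using h3.symm)
  obtain ⟨k, hk⟩ := isConj_iff.1 h4
  refine isConj_iff.2 ⟨φ k, ?_⟩
  have := congrArg φ hk
  simpa using this

end Automorphisms

/-! ### Letter counts, exponent sums and the symmetry between the generators -/

section Lengths

/-- The number of letters `x^{±1}` in the cyclically reduced form of `g`. -/
def letterCount {α : Type*} [DecidableEq α] (x : α) (g : FreeGroup α) : ℕ :=
  ((cyclicForm g).map Prod.fst).count x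

theorem wordLength_eq (s t : ℝ) (w : List (Fin 2 × Bool)) :
    wordLength ![s, t] w = s * (w.map Prod.fst).count 0 + t * (w.map Prod.fst).count 1 := by
  induction w with
  | nil => simp [wordLength]
  | cons x w ih =>
    obtain ⟨i, ε⟩ := x
    simp only [wordLength, List.map_cons, List.sum_cons] at ih ⊢
    rw [ih]
    fin_cases i <;> simp <;> ring

theorem classLength_mk (s t : ℝ) (g : F₂) :
    classLength ![s, t] (ConjClasses.mk g) = s * letterCount 0 g + t * letterCount 1 g :=
  wordLength_eq s t _

theorem isConj_mk_cyclicForm {α : Type*} [DecidableEq α] (g : FreeGroup α) :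
    IsConj (FreeGroup.mk (cyclicForm g)) g := by
  refine isConj_iff.2 ⟨FreeGroup.mk (FreeGroup.reduceCyclically.conjugator g.toWord), ?_⟩
  rw [FreeGroup.inv_mk, FreeGroup.mul_mk, FreeGroup.mul_mk, cyclicForm,
    FreeGroup.reduceCyclically.conj_conjugator_reduceCyclically, FreeGroup.mk_toWord]

theorem exponents_eq_of_isConj {g h : F₂} (H : IsConj g h) :
    expA g = expA h ∧ expB g = expB h := by
  obtain ⟨k, rfl⟩ := isConj_iff.1 H
  simp

theorem abs_exponents_mk_le (w : List (Fin 2 × Bool)) :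
    |expA (FreeGroup.mk w)| ≤ (w.map Prod.fst).count 0 ∧
      |expB (FreeGroup.mk w)| ≤ (w.map Prod.fst).count 1 := by
  induction w with
  | nil => simp [← FreeGroup.one_eq_mk]
  | cons x w ih =>
    have hx : ∀ i, (FreeGroup.mk [(i, true)] : F₂) = FreeGroup.of i := fun _ => rfl
    have hx' : ∀ i, (FreeGroup.mk [(i, false)] : F₂) = (FreeGroup.of i)⁻¹ := fun _ => rfl
    rw [← List.singleton_append, ← FreeGroup.mul_mk]
    obtain ⟨i, ε⟩ := x
    rw [abs_le, abs_le] at ih ⊢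
    fin_cases i <;> cases ε <;> simp [hx, hx'] <;> omega

/-- Exponent sums are conjugation invariant, so they can be read off the cyclically reduced form. -/
theorem abs_exponents_le_letterCount (g : F₂) :
    |expA g| ≤ letterCount 0 g ∧ |expB g| ≤ letterCount 1 g := by
  obtain ⟨h1, h2⟩ := exponents_eq_of_isConj (isConj_mk_cyclicForm g)
  rw [← h1, ← h2]
  exact abs_exponents_mk_le _

theorem IsPrimitive.exponents_ne_zero {g : F₂} (hg : IsPrimitive g) :
    expA g ≠ 0 ∨ expB g ≠ 0 := by
  obtain ⟨φ, rfl⟩ := hg.exists_mulAut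
  by_contra! h
  have h1 := expA_map (φ⁻¹ : MulAut F₂).toMonoidHom (φ genA)
  rw [h.1, h.2] at h1
  simp at h1

theorem cyclicForm_freeGroupCongr {α β : Type*} [DecidableEq α] [DecidableEq β] (e : α ≃ β)
    (g : FreeGroup α) :
    cyclicForm (FreeGroup.freeGroupCongr e g) = (cyclicForm g).map (Prod.map e id) := by
  have h1 : (FreeGroup.freeGroupCongr e g).toWord = g.toWord.map (Prod.map e id) := by
    have h2 : FreeGroup.freeGroupCongr e g = FreeGroup.mk (g.toWord.map (Prod.map e id)) := by
      conv_lhs => rw [← FreeGroup.mk_toWord (x := g)]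
      rfl
    have h3 : FreeGroup.IsReduced (g.toWord.map (Prod.map e id)) := by
      unfold FreeGroup.IsReduced
      rw [List.isChain_map]
      refine FreeGroup.isReduced_toWord.imp ?_
      intro p q hpq h
      exact hpq (e.injective h)
    rw [h2, FreeGroup.toWord_mk, h3.reduce_eq]
  rw [cyclicForm, h1, cyclicForm]
  generalize g.toWord = w
  induction w using List.bidirectionalRec with
  | nil => simp
  | singleton x => simp
  | cons_append x w y ih =>
    rw [List.map_cons, List.map_append, List.map_singleton,
      FreeGroup.reduceCyclically.cons_append, FreeGroup.reduceCyclically.cons_append, ih]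
    simp only [Prod.map_fst, Prod.map_snd, e.apply_eq_iff_eq, id]
    split_ifs <;> simp

theorem classLength_map_freeGroupCongr {α β : Type*} [DecidableEq α] [DecidableEq β] (e : α ≃ β)
    (L : β → ℝ) (c : ConjClasses (FreeGroup α)) :
    classLength L (c.map (FreeGroup.freeGroupCongr e).toMonoidHom) = classLength (L ∘ e) c := by
  obtain ⟨g, rfl⟩ := ConjClasses.exists_rep c
  change wordLength L (cyclicForm (FreeGroup.freeGroupCongr e g)) =
    wordLength (L ∘ e) (cyclicForm g)
  rw [cyclicForm_freeGroupCongr]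
  simp [wordLength, Function.comp_def]

theorem mem_primitiveClasses_map {α : Type*} (e : FreeGroup α ≃* FreeGroup α)
    {c : ConjClasses (FreeGroup α)} (hc : c ∈ primitiveClasses α) :
    c.map e.toMonoidHom ∈ primitiveClasses α := by
  obtain ⟨_, ⟨ι, b, i, rfl⟩, rfl⟩ := hc
  exact ⟨e (b i), ⟨ι, b.map e, i, by simp⟩, rfl⟩

/-- Relabelling the generators does not change the sum over the primitive classes. -/
theorem primitiveSum_comp_equiv {α : Type*} [DecidableEq α] (e : Equiv.Perm α) (f : ℝ → ℝ)
    (L : α → ℝ) : primitiveSum f (L ∘ e) = primitiveSum f L := by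
  let E := FreeGroup.freeGroupCongr e
  have hmap : ∀ (φ ψ : FreeGroup α ≃* FreeGroup α), (∀ x, φ (ψ x) = x) → ∀ c,
      (ConjClasses.map ψ.toMonoidHom c).map φ.toMonoidHom = c := by
    intro φ ψ h c
    obtain ⟨g, rfl⟩ := ConjClasses.exists_rep c
    change ConjClasses.mk (φ (ψ g)) = _
    rw [h]
  let T : primitiveClasses α ≃ primitiveClasses α :=
    { toFun := fun c => ⟨_, mem_primitiveClasses_map E c.2⟩
      invFun := fun c => ⟨_, mem_primitiveClasses_map E.symm c.2⟩
      left_inv := fun c => Subtype.ext (hmap _ _ E.symm_apply_apply _)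
      right_inv := fun c => Subtype.ext (hmap _ _ E.apply_symm_apply _) }
  unfold primitiveSum
  rw [← T.tsum_eq fun c => ENNReal.ofReal (f (classLength L c))]
  refine tsum_congr fun c => ?_
  rw [show ((T c : primitiveClasses α) : ConjClasses (FreeGroup α)) =
    ConjClasses.map E.toMonoidHom c from rfl, classLength_map_freeGroupCongr]

theorem P_one_sub (f : ℝ → ℝ) (t : ℝ) : P f (1 - t) = P f t := by
  unfold P
  rw [← primitiveSum_comp_equiv (Equiv.swap 0 1)]
  congr 1
  ext i
  fin_cases i <;> simp

end Lengths

/-! ### Convexity, lattice summation and length bounds -/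

section Analysis

/-- A strictly convex nonnegative function on the half-line that decays to zero is positive. -/
theorem pos_of_strictConvexOn {f : ℝ → ℝ} (hf : StrictConvexOn ℝ (Ioi 0) f)
    (h0 : ∀ x, 0 < x → 0 ≤ f x) (hlim : Tendsto f atTop (𝓝 0)) {x : ℝ} (hx : 0 < x) : 0 < f x := by
  refine (h0 x hx).lt_of_ne fun h => ?_
  -- For `x < y < z`, convexity gives `f y ≤ max (f x) (f z) = f z`, and `f z` tends to zero.
  have hzero : ∀ y, x < y → f y = 0 := by
    intro y hy
    refine le_antisymm (ge_of_tendsto hlim ?_) (h0 y (hx.trans hy))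
    filter_upwards [eventually_gt_atTop y] with z hz
    have := hf.convexOn.le_max_of_mem_Icc (mem_Ioi.2 hx) (mem_Ioi.2 (hx.trans (hy.trans hz)))
      ⟨hy.le, hz.le⟩
    rwa [← h, max_eq_right (h0 z (hx.trans (hy.trans hz)))] at this
  have h1 := hf.2 (mem_Ioi.2 (show 0 < x + 1 by linarith)) (mem_Ioi.2 (show 0 < x + 3 by linarith))
    (by linarith) (show (0 : ℝ) < 1 / 2 by norm_num) (show (0 : ℝ) < 1 / 2 by norm_num)
    (by norm_num)
  rw [hzero (x + 1) (by linarith), hzero (x + 3) (by linarith)] at h1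
  simp only [smul_eq_mul] at h1
  linarith [h0 (1 / 2 * (x + 1) + 1 / 2 * (x + 3)) (by linarith)]

theorem tendsto_zero_of_rpow_mul {f : ℝ → ℝ} (h0 : ∀ x, 0 < x → 0 ≤ f x) {k : ℝ} (hk : 0 ≤ k)
    (h : Tendsto (fun x : ℝ => x ^ k * f x) atTop (𝓝 0)) : Tendsto f atTop (𝓝 0) := by
  refine tendsto_of_tendsto_of_tendsto_of_le_of_le' tendsto_const_nhds h ?_ ?_
  · filter_upwards [eventually_gt_atTop 0] with x hx using h0 x hx
  · filter_upwards [eventually_ge_atTop 1] with x hx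
    exact le_mul_of_one_le_left (h0 x (by linarith)) (Real.one_le_rpow hx hk)

/-- A function that decays faster than `x ^ (-k)`, `k > 2`, is summable along lengths that grow
linearly with distinct lattice points of the plane. -/
theorem summable_of_lattice {ι : Type*} {f : ℝ → ℝ} {k : ℝ} (hk : 2 < k)
    (h : Tendsto (fun x : ℝ => x ^ k * f x) atTop (𝓝 0)) (v : ι → Fin 2 → ℤ)
    (hv : Function.Injective v) (ℓ : ι → ℝ) {δ : ℝ} (hδ : 0 < δ) (hℓ : ∀ i, δ * ‖v i‖ ≤ ℓ i) :
    Summable fun i => f (ℓ i) := by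
  have h1 : Summable fun i => ‖v i‖ ^ (-k) :=
    (EisensteinSeries.summable_one_div_norm_rpow hk).comp_injective hv
  have h2 : Tendsto (fun i => ‖v i‖) cofinite atTop := by
    have h3 : Tendsto (fun x : Fin 2 → ℤ => ‖x‖) cofinite atTop := by
      rw [← cocompact_eq_cofinite]
      exact tendsto_norm_cocompact_atTop
    exact h3.comp hv.tendsto_cofinite
  have h3 : Tendsto ℓ cofinite atTop := tendsto_atTop_mono hℓ (h2.const_mul_atTop hδ)
  -- All but finitely many lengths satisfy `|ℓ ^ k * f ℓ| < 1`.
  have h4 := (h.comp h3).eventually (Metric.ball_mem_nhds 0 one_pos)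
  refine summable_of_isBigO h1 (Asymptotics.IsBigO.of_bound (δ ^ (-k)) ?_)
  filter_upwards [h4, h2.eventually_gt_atTop 0] with i hi hpos
  have h5 : 0 < δ * ‖v i‖ := mul_pos hδ hpos
  have h6 : 0 < ℓ i := h5.trans_le (hℓ i)
  simp only [Function.comp_apply, dist_zero_right, norm_mul] at hi
  rw [Real.norm_of_nonneg (Real.rpow_nonneg h6.le k)] at hi
  rw [Real.norm_of_nonneg (Real.rpow_nonneg (norm_nonneg _) _), ← Real.mul_rpow hδ.le (norm_nonneg _)]
  calc ‖f (ℓ i)‖ ≤ ℓ i ^ (-k) := by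
        rw [Real.rpow_neg h6.le, ← one_div, le_div_iff₀ (Real.rpow_pos_of_pos h6 k), mul_comm]
        exact hi.le
    _ ≤ (δ * ‖v i‖) ^ (-k) := Real.rpow_le_rpow_of_nonpos h5 (hℓ i) (by linarith)

/-- A representative of a primitive conjugacy class. -/
noncomputable def primitiveRep (c : primitiveClasses (Fin 2)) : F₂ := c.2.choose

theorem isPrimitive_primitiveRep (c : primitiveClasses (Fin 2)) : IsPrimitive (primitiveRep c) :=
  c.2.choose_spec.1

theorem mk_primitiveRep (c : primitiveClasses (Fin 2)) : ConjClasses.mk (primitiveRep c) = c :=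
  c.2.choose_spec.2

/-- The length of a primitive class in the metric structure `(t, 1 - t)`. -/
noncomputable def len (c : primitiveClasses (Fin 2)) (t : ℝ) : ℝ :=
  t * letterCount 0 (primitiveRep c) + (1 - t) * letterCount 1 (primitiveRep c)

theorem classLength_eq_len (c : primitiveClasses (Fin 2)) (t : ℝ) :
    classLength ![t, 1 - t] c = len c t := by
  rw [← mk_primitiveRep c, classLength_mk]
  simp only [len]

/-- The abelianization of a primitive class. -/
noncomputable def primitiveVec (c : primitiveClasses (Fin 2)) : Fin 2 → ℤ :=
  ![expA (primitiveRep c), expB (primitiveRep c)]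

theorem primitiveVec_injective : Function.Injective primitiveVec := by
  intro c d h
  have h0 := congrFun h 0
  have h1 := congrFun h 1
  simp only [primitiveVec, Matrix.cons_val_zero, Matrix.cons_val_one] at h0 h1
  apply Subtype.ext
  rw [← mk_primitiveRep c, ← mk_primitiveRep d, ConjClasses.mk_eq_mk_iff_isConj]
  exact (isPrimitive_primitiveRep c).isConj (isPrimitive_primitiveRep d) h0 h1

theorem min_mul_norm_le_len (c : primitiveClasses (Fin 2)) {t : ℝ} (ht : t ∈ Ioo (0 : ℝ) 1) :
    min t (1 - t) * ‖primitiveVec c‖ ≤ len c t := by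
  obtain ⟨h1, h2⟩ := abs_exponents_le_letterCount (primitiveRep c)
  have h1' : (|(expA (primitiveRep c) : ℝ)|) ≤ letterCount 0 (primitiveRep c) := by exact_mod_cast h1
  have h2' : (|(expB (primitiveRep c) : ℝ)|) ≤ letterCount 1 (primitiveRep c) := by exact_mod_cast h2
  have ht0 : 0 ≤ t := ht.1.le
  have ht1 : 0 ≤ 1 - t := by linarith [ht.2]
  have h3 : ‖primitiveVec c‖ ≤ letterCount 0 (primitiveRep c) + letterCount 1 (primitiveRep c) := by
    rw [pi_norm_le_iff_of_nonneg (by positivity)]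
    intro i
    fin_cases i
    · simp only [primitiveVec, Int.norm_eq_abs, Fin.zero_eta, Matrix.cons_val_zero]
      exact h1'.trans (le_add_of_nonneg_right (by positivity))
    · simp only [primitiveVec, Int.norm_eq_abs, Fin.mk_one, Matrix.cons_val_one]
      exact h2'.trans (le_add_of_nonneg_left (by positivity))
  calc min t (1 - t) * ‖primitiveVec c‖ ≤ min t (1 - t) *
        (letterCount 0 (primitiveRep c) + letterCount 1 (primitiveRep c)) :=
        mul_le_mul_of_nonneg_left h3 (le_min ht0 ht1)
    _ ≤ len c t := by
        rw [mul_add, len]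
        gcongr
        · exact min_le_left _ _
        · exact min_le_right _ _

theorem len_pos (c : primitiveClasses (Fin 2)) {t : ℝ} (ht : t ∈ Ioo (0 : ℝ) 1) : 0 < len c t := by
  refine lt_of_lt_of_le (mul_pos (lt_min ht.1 (by linarith [ht.2])) (norm_pos_iff.2 ?_))
    (min_mul_norm_le_len c ht)
  intro h
  have h0 := congrFun h 0
  have h1 := congrFun h 1
  simp only [primitiveVec, Matrix.cons_val_zero, Matrix.cons_val_one, Pi.zero_apply] at h0 h1
  exact (isPrimitive_primitiveRep c).exponents_ne_zero.elim (· h0) (· h1)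

theorem len_combo (c : primitiveClasses (Fin 2)) {p q : ℝ} (hpq : p + q = 1) (s t : ℝ) :
    len c (p * s + q * t) = p * len c s + q * len c t := by
  obtain rfl : q = 1 - p := by linarith
  simp only [len]
  ring

/-- The conjugacy class of the first generator. -/
def classA : primitiveClasses (Fin 2) :=
  ⟨ConjClasses.mk genA, genA, isPrimitive_map 1 0, rfl⟩

/-- This length is not constant in `t`, so its term supplies the strict inequality in the convexity
of the sum. -/
theorem len_classA (t : ℝ) : len classA t = t := by
  rw [← classLength_eq_len]
  simp [classA, classLength_mk, letterCount, cyclicForm]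

theorem P_eq_tsum_len (f : ℝ → ℝ) (t : ℝ) : P f t = ∑' c, ENNReal.ofReal (f (len c t)) := by
  simp only [P, primitiveSum, classLength_eq_len]

end Analysis

end McShaneFree

/-! ### The main theorem -/

open McShaneFree

theorem theoremB (f : ℝ → ℝ)
    (hf_nonneg : ∀ x : ℝ, 0 < x → 0 ≤ f x)
    (hf_diff : ∀ x : ℝ, 0 < x → DifferentiableAt ℝ f x)
    (hf_diff2 : ∀ x : ℝ, 0 < x → DifferentiableAt ℝ (deriv f) x)
    (hf_convex : ∀ x : ℝ, 0 < x → 0 < deriv (deriv f) x)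
    (hf_decay : ∃ ε : ℝ, 0 < ε ∧ Tendsto (fun x : ℝ => x ^ (3 + ε) * f x) atTop (𝓝 0)) :
    (∀ t ∈ Ioo (0 : ℝ) 1, 0 < McShaneFree.P f t ∧ McShaneFree.P f t < ⊤) ∧
    StrictConvexOn ℝ (Ioo (0 : ℝ) 1) (fun t => (McShaneFree.P f t).toReal) ∧
    (∀ t ∈ Ioo (0 : ℝ) 1, t ≠ 1 / 2 → McShaneFree.P f (1 / 2) < McShaneFree.P f t) ∧
    (∀ U ∈ 𝓝 (1 / 2 : ℝ), ∃ s ∈ U ∩ Ioo (0 : ℝ) 1, ∃ t ∈ U ∩ Ioo (0 : ℝ) 1,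
      McShaneFree.P f s ≠ McShaneFree.P f t) ∧
    ¬ ∃ c : ENNReal, ∀ t ∈ Ioo (0 : ℝ) 1, McShaneFree.P f t = c := by
  obtain ⟨ε, hε, hlim⟩ := hf_decay
  have hconv : StrictConvexOn ℝ (Ioi 0) f := by
    refine strictConvexOn_of_deriv2_pos (convex_Ioi 0)
      (fun x hx => (hf_diff x hx).continuousAt.continuousWithinAt) fun x hx => ?_
    rw [interior_Ioi] at hx
    exact hf_convex x hx
  have hpos : ∀ x, 0 < x → 0 < f x := fun x hx => pos_of_strictConvexOn hconv hf_nonneg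
    (tendsto_zero_of_rpow_mul hf_nonneg (by linarith) hlim) hx
  have hsum : ∀ t ∈ Ioo (0 : ℝ) 1, Summable fun c => f (len c t) := fun t ht =>
    summable_of_lattice (by linarith) hlim primitiveVec primitiveVec_injective _
      (lt_min ht.1 (by linarith [ht.2])) fun c => min_mul_norm_le_len c ht
  have hP : ∀ t ∈ Ioo (0 : ℝ) 1, P f t = ENNReal.ofReal (∑' c, f (len c t)) := by
    intro t ht
    rw [P_eq_tsum_len, ENNReal.ofReal_tsum_of_nonneg (fun c => (hpos _ (len_pos c ht)).le)
      (hsum t ht)]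
  have hPreal : ∀ t ∈ Ioo (0 : ℝ) 1, (P f t).toReal = ∑' c, f (len c t) := by
    intro t ht
    rw [hP t ht, ENNReal.toReal_ofReal (tsum_nonneg fun c => (hpos _ (len_pos c ht)).le)]
  have hfin : ∀ t ∈ Ioo (0 : ℝ) 1, P f t < ⊤ := fun t ht => hP t ht ▸ ENNReal.ofReal_lt_top
  have hstrict : StrictConvexOn ℝ (Ioo (0 : ℝ) 1) fun t => (P f t).toReal := by
    refine ⟨convex_Ioo 0 1, fun s hs t ht hst p q hp hq hpq => ?_⟩
    have hm := convex_Ioo (0 : ℝ) 1 hs ht hp.le hq.le hpq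
    simp only [smul_eq_mul] at hm ⊢
    rw [hPreal s hs, hPreal t ht, hPreal _ hm, ← tsum_mul_left, ← tsum_mul_left,
      ← ((hsum s hs).mul_left p).tsum_add ((hsum t ht).mul_left q)]
    refine Summable.tsum_lt_tsum (i := classA) (fun c => ?_) ?_ (hsum _ hm)
      (((hsum s hs).mul_left p).add ((hsum t ht).mul_left q))
    · rw [len_combo c hpq]
      exact hconv.convexOn.2 (len_pos c hs) (len_pos c ht) hp.le hq.le hpq
    · simp only [len_classA]
      exact hconv.2 hs.1 ht.1 hst hp hq hpq
  have hmin : ∀ t ∈ Ioo (0 : ℝ) 1, t ≠ 1 / 2 → P f (1 / 2) < P f t := by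
    intro t ht hne
    have hhalf : (1 / 2 : ℝ) ∈ Ioo (0 : ℝ) 1 := by norm_num
    have ht' : 1 - t ∈ Ioo (0 : ℝ) 1 := ⟨by linarith [ht.2], by linarith [ht.1]⟩
    -- The point `1/2` is the midpoint of `t` and `1 - t`, where the sum takes equal values.
    have h := hstrict.2 ht ht' (fun h => hne (by linarith)) (show (0 : ℝ) < 1 / 2 by norm_num)
      (show (0 : ℝ) < 1 / 2 by norm_num) (by norm_num)
    simp only [smul_eq_mul, P_one_sub] at h
    rw [show 1 / 2 * t + 1 / 2 * (1 - t) = 1 / 2 by ring] at h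
    rw [← ENNReal.toReal_lt_toReal (hfin _ hhalf).ne (hfin t ht).ne]
    linarith
  have hnbhd : ∀ U ∈ 𝓝 (1 / 2 : ℝ), ∃ s ∈ U ∩ Ioo (0 : ℝ) 1, ∃ t ∈ U ∩ Ioo (0 : ℝ) 1,
      P f s ≠ P f t := by
    intro U hU
    have hhalf : (1 / 2 : ℝ) ∈ Ioo (0 : ℝ) 1 := by norm_num
    have h1 : U ∩ Ioo (0 : ℝ) 1 ∈ 𝓝 (1 / 2 : ℝ) := inter_mem hU (isOpen_Ioo.mem_nhds hhalf)
    have h2 : ∀ᶠ t in 𝓝[≠] (1 / 2 : ℝ), t ∈ U ∩ Ioo (0 : ℝ) 1 ∧ t ≠ 1 / 2 :=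
      Filter.Eventually.and (mem_nhdsWithin_of_mem_nhds h1) self_mem_nhdsWithin
    obtain ⟨t, ht, hne⟩ := h2.exists
    exact ⟨1 / 2, mem_of_mem_nhds h1, t, ht, (hmin t ht.2 hne).ne⟩
  refine ⟨fun t ht => ⟨?_, hfin t ht⟩, hstrict, hmin, hnbhd, ?_⟩
  · rw [P_eq_tsum_len]
    exact (ENNReal.ofReal_pos.2 (hpos _ (len_pos classA ht))).trans_le (ENNReal.le_tsum classA)
  · rintro ⟨c, hc⟩
    obtain ⟨s, hs, t, ht, hst⟩ := hnbhd univ univ_mem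
    exact hst ((hc s hs.2).trans (hc t ht.2).symm)
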